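/- A \emph{(multi-head) Hyper Temporal Network (HyTN)} $\mathcal{H}=(V,\mathcal{A})$ consists of a finite set $V$ of nodes and a finite set $\mathcal{A}$ of hyperarcs. Each hyperarc $A=(t_A,H_A,w_A)\in\mathcal{A}$ has a tail $t_A\in V$, a nonempty set of heads $H_A\subseteq V\setminus\{t_A\}$, and a weight $w_A(v)\in\mathbb{R}$ for every head $v\in H_A$. A schedule $s:V\to\mathbb{R}$ is \emph{feasible} if $$s(t_A)\ \ge\ \min_{v\in H_A}\{s(v)-w_A(v)\}\qquad\text{for every }A\in\mathcal{A},$$ and $\mathcal{H}$ is \emph{consistent} if it admits a feasible schedule. A \emph{cycle} of $\mathcal{H}$ is a pair $(S,\mathcal{C})$ with $\emptyset\ne S\subseteq V$ and $\mathcal{C}\subseteq\mathcal{A}$ such that $S=\bigcup_{A\in\mathcal{C}}(H_A\cup\{t_A\})$ and, for every $v\in S$, there is exactly one $A\in\mathcal{C}$ with $t_A=v$; this hyperarc is denoted $a(v)$. A \emph{finite cyclic sequence} in $(S,\mathcal{C})$ is a sequence $v_1,v_2,\dots,v_p$ of nodes of $S$ with $p\ge 2$ such that $v_{t+1}\in H_{a(v_t)}$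 for $1\le t<p$, $v_p=v_1$, and $v_1,\dots,v_{p-1}$ are pairwise distinct. The cycle $(S,\mathcal{C})$ is \emph{negative} if $$\sum_{t=1}^{p-1}w_{a(v_t)}(v_{t+1})<0$$ for every finite cyclic sequence $v_1,\dots,v_p$ in it. The network $\mathcal{H}$ is \emph{conservative} if it contains no negative cycle. \textbf{Theorem.} A HyTN $\mathcal{H}$ is consistent if and only if it is conservative. Moreover, when all weights $w_A(v)$ ($A\in\mathcal{A}$, $v\in H_A$) are integers, $\mathcal{H}$ admits a feasible schedule $s:V\to\mathbb{Z}$ if and only if it is conservative. -/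

import Mathlib

/-- A multi-head hyperarc `(t, H, w)` on the node type `V`: a tail `t`, a nonempty finite set `H` of
heads not containing `t`, and a real weight for each head. Only the values of `weight` on `heads`
are ever used. A standard arc is a hyperarc with exactly one head. -/
structure MultiHeadHyperarc (V : Type*) where
  tail : V
  heads : Finset V
  heads_nonempty : heads.Nonempty
  tail_notMem_heads : tail ∉ heads
  weight : V → ℝ

/-- A (multi-head) Hyper Temporal Network on the node set `V`: a finite set of weighted multi-head
hyperarcs. -/
structure HyTN (V : Type*) where
  arcs : Finset (MultiHeadHyperarc V)

namespace HyTN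

variable {V : Type*}

/-- A schedule is feasible if `s (t_A) ≥ min_{v ∈ H_A} (s v - w_A v)` for every hyperarc `A`. -/
def IsFeasible (H : HyTN V) (s : V → ℝ) : Prop :=
  ∀ A ∈ H.arcs, s A.tail ≥ A.heads.inf' A.heads_nonempty (fun v => s v - A.weight v)

/-- A network is consistent if it admits a feasible schedule. -/
def IsConsistent (H : HyTN V) : Prop :=
  ∃ s : V → ℝ, H.IsFeasible s

/-- A network admits an integral schedule if it has a feasible schedule with integer values. -/
def HasIntegralSchedule (H : HyTN V) : Prop :=
  ∃ s : V → ℤ, H.IsFeasible (fun v => (s v : ℝ))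

/-- All weights of the network are integers. -/
def IsIntegral (H : HyTN V) : Prop :=
  ∀ A ∈ H.arcs, ∀ v ∈ A.heads, ∃ z : ℤ, A.weight v = z

/-- A cycle `(S, C)` of a network: a nonempty set `S` of nodes and a set `C` of hyperarcs of the
network such that `S` consists of all tails and heads of hyperarcs in `C`, and every node in `S` is
the tail of exactly one hyperarc in `C`. -/
structure Cycle (H : HyTN V) where
  nodes : Set V
  hyperarcs : Set (MultiHeadHyperarc V)
  hyperarcs_subset : ∀ A ∈ hyperarcs, A ∈ H.arcs
  nodes_eq : nodes = ⋃ A ∈ hyperarcs, ((A.heads : Set V) ∪ {A.tail})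
  nodes_nonempty : nodes.Nonempty
  existsUnique_arc : ∀ v ∈ nodes, ∃! A, A ∈ hyperarcs ∧ A.tail = v

namespace Cycle

variable {H : HyTN V}

/-- The unique hyperarc `a(v)` of the cycle whose tail is `v`. -/
noncomputable def arc (c : H.Cycle) (v : c.nodes) : MultiHeadHyperarc V :=
  (c.existsUnique_arc v v.2).choose

theorem arc_mem (c : H.Cycle) (v : c.nodes) : c.arc v ∈ c.hyperarcs :=
  (c.existsUnique_arc v v.2).choose_spec.1.1

theorem arc_tail (c : H.Cycle) (v : c.nodes) : (c.arc v).tail = v :=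
  (c.existsUnique_arc v v.2).choose_spec.1.2

theorem eq_arc (c : H.Cycle) (v : c.nodes) {A : MultiHeadHyperarc V} (hA : A ∈ c.hyperarcs)
    (ht : A.tail = v) : A = c.arc v :=
  (c.existsUnique_arc v v.2).choose_spec.2 A ⟨hA, ht⟩

/-- `v 0, v 1, …, v n` is a finite cyclic sequence of the cycle: `n ≥ 1`, each `v (i + 1)` is a head
of `a(v i)`, and `v n = v 0` is the only repetition. The values of `v` beyond `n` are ignored. -/
def IsCyclicSequence (c : H.Cycle) (n : ℕ) (v : ℕ → c.nodes) : Prop :=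
  0 < n ∧ (∀ i < n, (v (i + 1) : V) ∈ (c.arc (v i)).heads) ∧ v n = v 0 ∧
    ∀ i < n, ∀ j < n, v i = v j → i = j

/-- A cycle is negative if the total weight of every finite cyclic sequence in it is negative. -/
def IsNegative (c : H.Cycle) : Prop :=
  ∀ (n : ℕ) (v : ℕ → c.nodes), c.IsCyclicSequence n v →
    ∑ i ∈ Finset.range n, (c.arc (v i)).weight (v (i + 1)) < 0

end Cycle

/-- A network is conservative if it contains no negative cycle. -/
def IsConservative (H : HyTN V) : Prop :=
  ¬ ∃ c : H.Cycle, c.IsNegative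

end HyTN

/-! Necessity: a feasible schedule selects in each hyperarc of a cycle a head with `s u ≤ s v + w`.
Following these selections closes up into a cyclic sequence, around which the differences of `s`
telescope to zero, so its weight is nonnegative. Sufficiency is an induction on sets of hyperarcs,
`IsConservative.exists_satisfies`. If two hyperarcs share a tail, schedules omitting one or the
other are glued by `satisfies_min`. If some head is no tail, it can be lowered freely. Otherwise the
set is itself a cycle; a nonnegative cyclic sequence in it sustains itself by a potential, and
`exists_satisfies_of_override` lowers it as a block. Values stay in a subgroup `G` of `ℝ`, which
treats real and integral schedules together. -/

namespace HyTN

variable {V : Type*}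

/-- The pointwise form of feasibility for a set of hyperarcs. -/
def Satisfies (F : Finset (MultiHeadHyperarc V)) (s : V → ℝ) : Prop :=
  ∀ A ∈ F, ∃ v ∈ A.heads, s v ≤ s A.tail + A.weight v

theorem isFeasible_iff_satisfies (H : HyTN V) (s : V → ℝ) :
    H.IsFeasible s ↔ Satisfies H.arcs s := by
  simp only [IsFeasible, Satisfies, ge_iff_le, Finset.inf'_le_iff, sub_le_iff_le_add]

namespace Cycle

variable {H : HyTN V}

theorem mem_nodes_of_mem_heads (c : H.Cycle) {A : MultiHeadHyperarc V} (hA : A ∈ c.hyperarcs)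
    {v : V} (hv : v ∈ A.heads) : v ∈ c.nodes := by
  rw [c.nodes_eq]
  exact Set.mem_biUnion hA (Or.inl hv)

theorem not_isNegative_of_isFeasible [Finite V] (c : H.Cycle) {s : V → ℝ}
    (hs : H.IsFeasible s) : ¬ c.IsNegative := by
  intro hc
  rw [isFeasible_iff_satisfies] at hs
  have step : ∀ v : c.nodes, ∃ u : c.nodes, (u : V) ∈ (c.arc v).heads ∧
      s u ≤ s v + (c.arc v).weight u := by
    intro v
    obtain ⟨u, hu, hle⟩ := hs _ (c.hyperarcs_subset _ (c.arc_mem v))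
    rw [c.arc_tail] at hle
    exact ⟨⟨u, c.mem_nodes_of_mem_heads (c.arc_mem v) hu⟩, hu, hle⟩
  choose f hf hle using step
  obtain ⟨x₀, hx₀⟩ := c.nodes_nonempty
  obtain ⟨m, n, heq, hmn⟩ : ∃ m n, f^[m] ⟨x₀, hx₀⟩ = f^[n] ⟨x₀, hx₀⟩ ∧ m < n := by
    obtain ⟨m, n, hne, heq⟩ :=
      Finite.exists_ne_map_eq_of_infinite (fun k : ℕ => f^[k] ⟨x₀, hx₀⟩)
    rcases lt_or_gt_of_ne hne with h | h
    · exact ⟨m, n, heq, h⟩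
    · exact ⟨n, m, heq.symm, h⟩
  set x := f^[m] ⟨x₀, hx₀⟩ with hx
  have hper : x ∈ Function.periodicPts f := by
    refine Function.mk_mem_periodicPts (Nat.sub_pos_of_lt hmn) ?_
    change f^[n - m] x = x
    rw [hx, ← Function.iterate_add_apply, Nat.sub_add_cancel hmn.le, ← heq, hx]
  have hneg := hc (Function.minimalPeriod f x) (fun i => f^[i] x) ⟨
    Function.minimalPeriod_pos_of_mem_periodicPts hper,
    fun i _ => by simpa only [Function.iterate_succ_apply'] using hf (f^[i] x),
    Function.isPeriodicPt_minimalPeriod f x,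
    fun i hi j hj h => Function.iterate_injOn_Iio_minimalPeriod hi hj h⟩
  have htel := Finset.sum_range_sub (fun i => s (f^[i] x)) (Function.minimalPeriod f x)
  rw [(Function.isPeriodicPt_minimalPeriod f x).eq] at htel
  have hsum : ∑ i ∈ Finset.range (Function.minimalPeriod f x), (s (f^[i + 1] x) - s (f^[i] x)) ≤
      ∑ i ∈ Finset.range (Function.minimalPeriod f x),
        (c.arc (f^[i] x)).weight (f^[i + 1] x) := by
    refine Finset.sum_le_sum fun i _ => ?_
    have := hle (f^[i] x)
    rw [Function.iterate_succ_apply']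
    linarith
  simp only [Function.iterate_zero, id_eq, sub_self] at htel
  linarith

end Cycle

/-- Replacing a schedule on a self-sustaining set of nodes `T` by a low enough translate of a
schedule `p` for `T` preserves the hyperarcs with tail outside `T`. -/
theorem exists_satisfies_of_override {G : AddSubgroup ℝ} (hG : 1 ∈ G)
    {F : Finset (MultiHeadHyperarc V)} (T : Finset V) {p s : V → ℝ}
    (hp : ∀ v, p v ∈ G) (hsG : ∀ v, s v ∈ G)
    (hin : ∀ A ∈ F, A.tail ∈ T → ∃ v ∈ A.heads, v ∈ T ∧ p v ≤ p A.tail + A.weight v)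
    (hout : ∀ A ∈ F, A.tail ∉ T →
      (∃ v ∈ A.heads, v ∈ T) ∨ ∃ v ∈ A.heads, s v ≤ s A.tail + A.weight v) :
    ∃ s' : V → ℝ, (∀ v, s' v ∈ G) ∧ Satisfies F s' := by
  classical
  -- Finitely many lower bounds on the shift; a natural number keeps it in `G`.
  have hK : ∀ᶠ K : ℕ in Filter.atTop, ∀ A ∈ F, ∀ v ∈ T,
      p v - s A.tail - A.weight v ≤ (K : ℝ) := by
    simp only [Filter.eventually_all_finset]
    exact fun A _ v _ => tendsto_natCast_atTop_atTop.eventually_ge_atTop _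
  obtain ⟨K, hK⟩ := hK.exists
  have hKG : (K : ℝ) ∈ G := by simpa using G.nsmul_mem hG K
  refine ⟨fun v => if v ∈ T then p v - K else s v, fun v => ?_, fun A hA => ?_⟩
  · dsimp only
    split_ifs
    exacts [G.sub_mem (hp v) hKG, hsG v]
  · by_cases ht : A.tail ∈ T
    · obtain ⟨v, hv, hvT, hle⟩ := hin A hA ht
      refine ⟨v, hv, ?_⟩
      simp only [hvT, ht, if_true]
      linarith
    · by_cases hex : ∃ v ∈ A.heads, v ∈ T
      · obtain ⟨v, hv, hvT⟩ := hex
        refine ⟨v, hv, ?_⟩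
        simp only [hvT, ht, if_true, if_false]
        linarith [hK A hA v hvT]
      · obtain ⟨v, hv, hle⟩ := (hout A hA ht).resolve_left hex
        have hvT : v ∉ T := fun h => hex ⟨v, hv, h⟩
        refine ⟨v, hv, ?_⟩
        simpa only [hvT, ht, if_false] using hle

/-- Two schedules that agree at `t` combine to their minimum, when only hyperarcs with tail `t` can
be violated. -/
theorem satisfies_min {F : Finset (MultiHeadHyperarc V)} {s₁ s₂ : V → ℝ} {t : V}
    (ht : s₁ t = s₂ t)
    (h₁ : ∀ A ∈ F, A.tail ≠ t → ∃ v ∈ A.heads, s₁ v ≤ s₁ A.tail + A.weight v)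
    (h₂ : ∀ A ∈ F, A.tail ≠ t → ∃ v ∈ A.heads, s₂ v ≤ s₂ A.tail + A.weight v)
    (h : ∀ A ∈ F, A.tail = t → (∃ v ∈ A.heads, s₁ v ≤ s₁ A.tail + A.weight v) ∨
      ∃ v ∈ A.heads, s₂ v ≤ s₂ A.tail + A.weight v) :
    Satisfies F (fun v => min (s₁ v) (s₂ v)) := by
  intro A hA
  -- A schedule attaining the minimum at the tail supplies the head, whose value can only drop. At
  -- `t` both attain it, so either may serve.
  have key : (s₁ A.tail ≤ s₂ A.tail ∧ ∃ v ∈ A.heads, s₁ v ≤ s₁ A.tail + A.weight v) ∨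
      (s₂ A.tail ≤ s₁ A.tail ∧ ∃ v ∈ A.heads, s₂ v ≤ s₂ A.tail + A.weight v) := by
    by_cases hAt : A.tail = t
    · have heq : s₁ A.tail = s₂ A.tail := by rw [hAt, ht]
      exact (h A hA hAt).imp (fun h => ⟨heq.le, h⟩) (fun h => ⟨heq.ge, h⟩)
    · exact (le_total (s₁ A.tail) (s₂ A.tail)).imp (fun hl => ⟨hl, h₁ A hA hAt⟩)
        (fun hl => ⟨hl, h₂ A hA hAt⟩)
  rcases key with ⟨hl, v, hv, hle⟩ | ⟨hl, v, hv, hle⟩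
  · exact ⟨v, hv, by simpa only [min_eq_left hl] using (min_le_left _ _).trans hle⟩
  · exact ⟨v, hv, by simpa only [min_eq_right hl] using (min_le_right _ _).trans hle⟩

/-- A set of hyperarcs with pairwise distinct tails, all of whose heads are tails, is a cycle. -/
def Cycle.ofFinset {H : HyTN V} (F : Finset (MultiHeadHyperarc V)) (hF : F ⊆ H.arcs)
    (hne : F.Nonempty) (hinj : ∀ A ∈ F, ∀ B ∈ F, A.tail = B.tail → A = B)
    (hheads : ∀ A ∈ F, ∀ v ∈ A.heads, ∃ B ∈ F, B.tail = v) : H.Cycle where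
  nodes := {v | ∃ A ∈ F, A.tail = v}
  hyperarcs := F
  hyperarcs_subset := fun _ hA => hF hA
  nodes_eq := by
    ext v
    simp only [Set.mem_ofPred_eq, Set.mem_iUnion, Set.mem_union, Finset.mem_coe,
      Set.mem_singleton_iff, exists_prop]
    constructor
    · rintro ⟨A, hA, rfl⟩
      exact ⟨A, hA, Or.inr rfl⟩
    · rintro ⟨A, hA, hv | rfl⟩
      exacts [hheads A hA v hv, ⟨A, hA, rfl⟩]
  nodes_nonempty := hne.elim fun A hA => ⟨A.tail, A, hA, rfl⟩
  existsUnique_arc := by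
    rintro v ⟨A, hA, rfl⟩
    exact ⟨A, ⟨hA, rfl⟩, fun B hB => hinj B hB.1 A hA hB.2⟩

/-- A cyclic sequence of nonnegative weight carries a potential that satisfies its hyperarcs. -/
theorem Cycle.exists_potential {H : HyTN V} (c : H.Cycle) {G : AddSubgroup ℝ}
    (hw : ∀ A ∈ H.arcs, ∀ v ∈ A.heads, A.weight v ∈ G) {n : ℕ} {v : ℕ → c.nodes}
    (hv : c.IsCyclicSequence n v)
    (hnonneg : 0 ≤ ∑ i ∈ Finset.range n, (c.arc (v i)).weight (v (i + 1))) :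
    ∃ p : V → ℝ, (∀ u, p u ∈ G) ∧
      ∀ i < n, p (v (i + 1)) ≤ p (v i) + (c.arc (v i)).weight (v (i + 1)) := by
  classical
  obtain ⟨hn, hhead, hclose, hinj⟩ := hv
  -- Partial sums are tight on every step but the closing one, where nonnegativity of the total is
  -- used.
  let P : ℕ → ℝ := fun k => ∑ i ∈ Finset.range k, (c.arc (v i)).weight (v (i + 1))
  have hP : ∀ k ≤ n, P k ∈ G := fun k hk => G.sum_mem fun i hi =>
    hw _ (c.hyperarcs_subset _ (c.arc_mem _)) _
      (hhead i ((Finset.mem_range.1 hi).trans_le hk))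
  let p : V → ℝ := fun u => if h : ∃ i < n, (v i : V) = u then P h.choose else 0
  have hp : ∀ i < n, p (v i) = P i := by
    intro i hi
    have h : ∃ j < n, (v j : V) = v i := ⟨i, hi, rfl⟩
    have hj : h.choose = i :=
      hinj _ h.choose_spec.1 _ hi (Subtype.ext h.choose_spec.2)
    simp only [p, dif_pos h, hj]
  refine ⟨p, fun u => ?_, fun i hi => ?_⟩
  · by_cases h : ∃ i < n, (v i : V) = u
    · simp only [p, dif_pos h]
      exact hP _ h.choose_spec.1.le
    · simp only [p, dif_neg h]
      exact G.zero_mem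
  · have hsucc : P (i + 1) = P i + (c.arc (v i)).weight (v (i + 1)) := Finset.sum_range_succ _ _
    rw [hp i hi, ← hsucc]
    rcases Nat.lt_or_ge (i + 1) n with h | h
    · exact (hp _ h).le
    · obtain rfl : n = i + 1 := by omega
      rw [hclose, hp 0 hn]
      simpa [P] using hnonneg

theorem IsConservative.exists_satisfies {H : HyTN V} (hH : H.IsConservative) {G : AddSubgroup ℝ}
    (hG : 1 ∈ G) (hw : ∀ A ∈ H.arcs, ∀ v ∈ A.heads, A.weight v ∈ G)
    (F : Finset (MultiHeadHyperarc V)) (hF : F ⊆ H.arcs) :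
    ∃ s : V → ℝ, (∀ v, s v ∈ G) ∧ Satisfies F s := by
  classical
  induction F using Finset.strongInduction with
  | H F ih =>
  by_cases hinj : ∀ A ∈ F, ∀ B ∈ F, A.tail = B.tail → A = B
  swap
  · push Not at hinj
    obtain ⟨A, hA, B, hB, htail, hne⟩ := hinj
    obtain ⟨s₁, hs₁G, hs₁⟩ := ih _ (Finset.erase_ssubset hA) ((Finset.erase_subset _ _).trans hF)
    obtain ⟨s₂, hs₂G, hs₂⟩ := ih _ (Finset.erase_ssubset hB) ((Finset.erase_subset _ _).trans hF)
    have h₁ : ∀ C ∈ F, C ≠ A → ∃ v ∈ C.heads,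
        s₁ v - s₁ A.tail ≤ s₁ C.tail - s₁ A.tail + C.weight v := fun C hC hCA =>
      (hs₁ C (Finset.mem_erase.2 ⟨hCA, hC⟩)).imp fun v hv => ⟨hv.1, by linarith [hv.2]⟩
    have h₂ : ∀ C ∈ F, C ≠ B → ∃ v ∈ C.heads,
        s₂ v - s₂ A.tail ≤ s₂ C.tail - s₂ A.tail + C.weight v := fun C hC hCB =>
      (hs₂ C (Finset.mem_erase.2 ⟨hCB, hC⟩)).imp fun v hv => ⟨hv.1, by linarith [hv.2]⟩
    -- Translating both schedules to vanish at the common tail makes them agree there.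
    refine ⟨fun v => min (s₁ v - s₁ A.tail) (s₂ v - s₂ A.tail), fun v => ?_,
      satisfies_min (t := A.tail) (by simp) (fun C hC ht => h₁ C hC fun h => ht (h ▸ rfl))
        (fun C hC ht => h₂ C hC fun h => ht (by rw [h, htail])) fun C hC _ => ?_⟩
    · dsimp only
      rcases min_choice (s₁ v - s₁ A.tail) (s₂ v - s₂ A.tail) with h | h <;> rw [h]
      exacts [G.sub_mem (hs₁G _) (hs₁G _), G.sub_mem (hs₂G _) (hs₂G _)]
    · by_cases hCA : C = A
      · exact Or.inr (h₂ C hC (hCA ▸ hne))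
      · exact Or.inl (h₁ C hC hCA)
  by_cases hheads : ∀ A ∈ F, ∀ v ∈ A.heads, ∃ B ∈ F, B.tail = v
  swap
  · push Not at hheads
    obtain ⟨A, hA, h, hh, hsink⟩ := hheads
    obtain ⟨s, hsG, hs⟩ := ih _ (Finset.erase_ssubset hA) ((Finset.erase_subset _ _).trans hF)
    refine exists_satisfies_of_override hG {h} (p := fun _ => 0) (fun _ => G.zero_mem) hsG
      (fun B hB ht => (hsink B hB (Finset.mem_singleton.1 ht)).elim) fun B hB _ => ?_
    by_cases hBA : B = A
    · exact Or.inl ⟨h, hBA ▸ hh, Finset.mem_singleton_self h⟩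
    · exact Or.inr (hs B (Finset.mem_erase.2 ⟨hBA, hB⟩))
  rcases F.eq_empty_or_nonempty with rfl | hne
  · exact ⟨fun _ => 0, fun _ => G.zero_mem, fun A hA => (Finset.notMem_empty A hA).elim⟩
  let c : H.Cycle := Cycle.ofFinset F hF hne hinj hheads
  have hc : ¬ c.IsNegative := fun h => hH ⟨c, h⟩
  simp only [Cycle.IsNegative, not_forall, not_lt] at hc
  obtain ⟨n, v, hv, hnonneg⟩ := hc
  obtain ⟨p, hpG, hp⟩ := c.exists_potential hw hv hnonneg
  obtain ⟨hn, hhead, hclose, -⟩ := hv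
  let T : Finset V := (Finset.range n).image fun i => (v i : V)
  have hT : ∀ i < n, (v i : V) ∈ T := fun i hi =>
    Finset.mem_image_of_mem _ (Finset.mem_range.2 hi)
  -- Hyperarcs with tail on the sequence are handled by the potential, so the induction needs only
  -- the others.
  have hss : F.filter (fun A => A.tail ∉ T) ⊂ F := Finset.filter_ssubset.2
    ⟨c.arc (v 0), c.arc_mem (v 0), not_not.2 (by rw [c.arc_tail]; exact hT 0 hn)⟩
  obtain ⟨s, hsG, hs⟩ := ih _ hss (hss.subset.trans hF)
  refine exists_satisfies_of_override hG T hpG hsG (fun A hA ht => ?_)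
    fun A hA ht => Or.inr (hs A (Finset.mem_filter.2 ⟨hA, ht⟩))
  obtain ⟨i, hi, hit⟩ := Finset.mem_image.1 ht
  rw [Finset.mem_range] at hi
  obtain rfl : A = c.arc (v i) := c.eq_arc (v i) hA hit.symm
  refine ⟨v (i + 1), hhead i hi, ?_, ?_⟩
  · rcases Nat.lt_or_ge (i + 1) n with h | h
    · exact hT _ h
    · obtain rfl : n = i + 1 := by omega
      rw [hclose]
      exact hT 0 hn
  · rw [c.arc_tail]
    exact hp i hi

theorem IsConsistent.isConservative [Finite V] {H : HyTN V} (h : H.IsConsistent) :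
    H.IsConservative := by
  rintro ⟨c, hc⟩
  obtain ⟨s, hs⟩ := h
  exact c.not_isNegative_of_isFeasible hs hc

theorem IsConservative.isConsistent {H : HyTN V} (h : H.IsConservative) : H.IsConsistent := by
  obtain ⟨s, -, hs⟩ := h.exists_satisfies (G := ⊤) (AddSubgroup.mem_top _)
    (fun _ _ _ _ => AddSubgroup.mem_top _) H.arcs subset_rfl
  exact ⟨s, (isFeasible_iff_satisfies H s).2 hs⟩

theorem IsConservative.hasIntegralSchedule {H : HyTN V} (h : H.IsConservative)
    (hint : H.IsIntegral) : H.HasIntegralSchedule := by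
  obtain ⟨s, hsG, hs⟩ := h.exists_satisfies (G := (Int.castAddHom ℝ).range) ⟨1, by simp⟩
    (fun A hA v hv => (hint A hA v hv).imp fun z hz => hz.symm) H.arcs subset_rfl
  choose z hz using hsG
  obtain rfl : (fun v => (z v : ℝ)) = s := funext hz
  exact ⟨z, (isFeasible_iff_satisfies H _).2 hs⟩

theorem HasIntegralSchedule.isConsistent {H : HyTN V} (h : H.HasIntegralSchedule) :
    H.IsConsistent :=
  h.elim fun _ hs => ⟨_, hs⟩

end HyTN

theorem mainTheorem1 {V : Type*} [Finite V] (H : HyTN V) :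
    (H.IsConsistent ↔ H.IsConservative) ∧
      (H.IsIntegral → (H.HasIntegralSchedule ↔ H.IsConservative)) :=
  ⟨⟨fun h => h.isConservative, fun h => h.isConsistent⟩,
    fun hint => ⟨fun h => h.isConsistent.isConservative, fun h => h.hasIntegralSchedule hint⟩⟩
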